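/- Let $\mathcal G$ be a locally coherent Grothendieck category, i.e. a Grothendieck category which is locally finitely presented and whose full subcategory $\mathrm{fp}\,\mathcal G$ of finitely presented objects is an abelian subcategory (closed under finite direct sums, kernels and cokernels in $\mathcal G$). Say that an object $X$ of the bounded derived category $D^b(\mathcal G)$ is of type $FP_\infty$ if for every direct system $(M_i \mid i\in I)$ in $\mathcal G$, indexed by a (small, non-empty) directed partially ordered set $I$, and every $n\in\mathbb Z$ the natural map $$\varinjlim_{i\in I}\operatorname{Hom}_{D^b(\mathcal G)}(X,M_i[n])\longrightarrow \operatorname{Hom}_{D^b(\mathcal G)}\bigl(X,(\varinjlim_{i\in I}M_i)[n]\bigr)$$ is an isomorphism. Say that $X\in D^b(\mathcal G)$ lies in $D^b(\mathrm{fp}\,\mathcal G)$ if $X$ is in the essential image of the functor $D^b(\mathrm{fp}\,\mathcal G)\to D^b(\mathcal G)$ induced by the exact inclusion $\mathrm{fp}\,\mathcal G\subseteq\mathcal G$. Let $D^b(\mathcal G)^c$ denote the full subcategory of compact objects of $D^b(\mathcal G)$, i.e. of those $C$ such that for every (small) family $(X_j\mid j\in J)$ whose coproduct exists in $D^b(\mathcal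 G)$ the canonical map $\bigoplus_{j\in J}\operatorname{Hom}(C,X_j)\to\operatorname{Hom}(C,\coprod_{j\in J}X_j)$ is an isomorphism. Then: 1. An object $X\in D^b(\mathcal G)$ is of type $FP_\infty$ if and only if it lies in $D^b(\mathrm{fp}\,\mathcal G)$. 2. $D^b(\mathrm{fp}\,\mathcal G)\subseteq D^b(\mathcal G)^c$. -/

import Mathlib

open CategoryTheory Limits Opposite

universe w₁ w₂ w v u

noncomputable section

namespace LocallyCoherent

/-! ### Natural maps out of direct limits and direct sums of Hom groups -/

section Hom

variable {T : Type u} [Category.{w} T] [Preadditive T]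

/-- Postcomposition with `f : Y ⟶ Z`, as a homomorphism `Hom(X, Y) → Hom(X, Z)`. -/
def postcomp (X : T) {Y Z : T} (f : Y ⟶ Z) : (X ⟶ Y) →+ (X ⟶ Z) :=
  Preadditive.rightComp X f

/-- For a direct system `(D i | i ∈ I)` in `T` and a cocone `c` on it, the natural map
`lim→ Hom(X, D i) → Hom(X, c)` of abelian groups. -/
def homDirectLimitMap (X : T) {I : Type v} [PartialOrder I] [DecidableEq I] {D : I ⥤ T}
    (c : Cocone D) :
    AddCommGroup.DirectLimit (fun i => X ⟶ D.obj i)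
      (fun _ _ h => postcomp X (D.map (homOfLE h))) →+ (X ⟶ c.pt) :=
  AddCommGroup.DirectLimit.lift _ _ _ (fun i => postcomp X (c.ι.app i)) (by
    intro i j h x
    simp [postcomp, Preadditive.rightComp])

/-- For a family `(Y j | j ∈ J)` in `T` and a cofan `c` on it, the natural map
`⨁ Hom(X, Y j) → Hom(X, c)` of abelian groups. -/
def homDirectSumMap (X : T) {J : Type v} [DecidableEq J] {Y : J → T} (c : Cofan Y) :
    DirectSum J (fun j => X ⟶ Y j) →+ (X ⟶ c.pt) :=
  DirectSum.toAddMonoid (fun j => postcomp X (c.inj j))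

open Classical in
variable (T) in
/-- The compact objects of `T`: those `X` such that `Hom(X, -)` commutes with all
(`v`-small) coproducts which exist in `T`. -/
def compactObjects : ObjectProperty T := fun X =>
  ∀ (J : Type v) (Y : J → T) (c : Cofan Y), IsColimit c →
    Function.Bijective (homDirectSumMap X c)

end Hom

/-! ### Locally coherent categories -/

variable (G : Type u) [Category.{v} G] [Abelian G]

/-- The property of being finitely presented: `Hom(X, -)` commutes with filtered colimits. -/
abbrev fp : ObjectProperty G := ObjectProperty.isFinitelyPresentable.{v} G

/-- The full subcategory `fp G` of finitely presented objects of `G`. -/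
abbrev Fp : Type u := (fp G).FullSubcategory

/-- `G` is locally coherent if it is locally finitely presented and the finitely presented
objects form an abelian subcategory, i.e. a subcategory closed under finite direct sums, kernels
and cokernels. Only the closure under kernels is a condition: see the instances below. -/
class IsLocallyCoherent : Prop where
  locallyFinitelyPresentable : IsLocallyFinitelyPresentable.{v} G
  closedUnderKernels : (fp G).IsClosedUnderKernels

attribute [instance] IsLocallyCoherent.closedUnderKernels

section

attribute [local instance] Cardinal.fact_isRegular_aleph0

lemma fp_isClosedUnderColimitsOfShape (J : Type) [SmallCategory J] [FinCategory J] :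
    (fp G).IsClosedUnderColimitsOfShape J :=
  isClosedUnderColimitsOfShape_isCardinalPresentable G (κ := Cardinal.aleph0.{v}) (J := J) (by
    rw [hasCardinalLT_aleph0_iff, Arrow.finite_iff]
    exact ⟨inferInstance⟩)

instance fp_isClosedUnderIsomorphisms : (fp G).IsClosedUnderIsomorphisms :=
  inferInstanceAs (isCardinalPresentable G Cardinal.aleph0.{v}).IsClosedUnderIsomorphisms

end

instance fp_containsZero : (fp G).ContainsZero where
  exists_zero := by
    have := fp_isClosedUnderColimitsOfShape G (Discrete PEmpty)
    exact ⟨_, (isZero_zero G).of_iso (HasZeroObject.zeroIsoInitial (C := G)).symm,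
      (fp G).prop_colimit (Functor.empty.{0} G) (by rintro ⟨⟨⟩⟩)⟩

instance fp_isClosedUnderFiniteProducts : (fp G).IsClosedUnderFiniteProducts where
  isClosedUnderLimitsOfShape J _ := by
    have := Abelian.hasFiniteBiproducts (C := G)
    have := Fintype.ofFinite J
    classical
    have := fp_isClosedUnderColimitsOfShape G (Discrete J)
    refine ⟨?_⟩
    rintro X ⟨p⟩
    let f : J → G := fun j => p.diag.obj ⟨j⟩
    have h : fp G (⨁ f) :=
      (fp G).prop_of_isColimit (biproduct.isColimit f) (fun j => p.prop_diag_obj j)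
    exact (fp G).prop_of_iso ((biproduct.isLimit f).conePointsIsoOfNatIso p.isLimit
      (Discrete.natIso (fun _ => Iso.refl _))) h

instance fp_isClosedUnderCokernels : (fp G).IsClosedUnderCokernels where
  cokernels_le := by
    rintro _ ⟨f, k, hk, hX, hY⟩
    have := fp_isClosedUnderColimitsOfShape G WalkingParallelPair
    exact (fp G).prop_of_isColimit hk (by rintro (_ | _) <;> assumption)

section

variable [IsLocallyCoherent G]

instance fp_preservesFiniteLimits : PreservesFiniteLimits (fp G).ι :=
  have := (fp G).preservesKernels_ι
  Functor.preservesFiniteLimits_of_preservesKernels _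

instance fp_preservesFiniteColimits : PreservesFiniteColimits (fp G).ι :=
  have := (fp G).preservesCokernels_ι
  Functor.preservesFiniteColimits_of_preservesCokernels _

end

/-! ### Bounded derived categories -/

open DerivedCategory DerivedCategory.TStructure

section

variable [HasDerivedCategory.{w₁} G]

/-- The functor `G ⥤ D^b(G)` sending an object to the complex concentrated in degree `0`. -/
def stalk : G ⥤ Bounded G :=
  t.bounded.lift (singleFunctor G 0)
    (fun _ => ⟨⟨0, inferInstance⟩, ⟨0, inferInstance⟩⟩)

variable {G}

open Classical in
/-- An object `X` of `D^b(G)` is of type `FP_∞` if for each direct system `(M i | i ∈ I)` in `G`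
and each `n : ℤ` the natural map `lim→ Hom(X, (M i)[n]) → Hom(X, (lim→ M i)[n])` is an
isomorphism. -/
def IsFPInfty (X : Bounded G) : Prop :=
  ∀ (I : Type v) [PartialOrder I] [IsDirectedOrder I] [Nonempty I] (M : I ⥤ G) (c : Cocone M),
    IsColimit c → ∀ n : ℤ,
      Function.Bijective (homDirectLimitMap X ((stalk G ⋙ shiftFunctor (Bounded G) n).mapCocone c))

end

section

variable [HasDerivedCategory.{w₁} G] [IsLocallyCoherent G] [HasDerivedCategory.{w₂} (Fp G)]

/-- The functor `D^b(fp G) ⥤ D^b(G)` induced by the (exact) inclusion of `fp G` in `G`. -/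
def boundedFpInclusion : Bounded (Fp G) ⥤ Bounded G :=
  t.bounded.lift (Bounded.ι ⋙ (fp G).ι.mapDerivedCategory) (by
    have hQ (K : CochainComplex (Fp G) ℤ) := (fp G).ι.mapDerivedCategoryFactors.app K
    rintro ⟨X, ⟨a, ha⟩, ⟨b, hb⟩⟩
    refine ⟨⟨a, ⟨?_⟩⟩, ⟨b, ⟨?_⟩⟩⟩
    · obtain ⟨K, e, hK⟩ := ha
      exact ⟨_, (fp G).ι.mapDerivedCategory.mapIso e ≪≫ hQ K,
        (CochainComplex.isStrictlyGE_mapHomologicalComplex_obj_iff K (fp G).ι a).2 hK⟩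
    · obtain ⟨K, e, hK⟩ := hb
      exact ⟨_, (fp G).ι.mapDerivedCategory.mapIso e ≪≫ hQ K,
        (CochainComplex.isStrictlyLE_mapHomologicalComplex_obj_iff K (fp G).ι b).2 hK⟩)

/-- The objects of `D^b(G)` belonging to `D^b(fp G)`, i.e. the essential image of
the functor `D^b(fp G) ⥤ D^b(G)`. -/
def boundedFp : ObjectProperty (Bounded G) := (boundedFpInclusion.{w₁, w₂} G).essImage

end

end LocallyCoherent

end

noncomputable section

namespace LocallyCoherent

/-! ### Finitely presented objects in a locally coherent category -/

section
section Fp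

attribute [local instance] Cardinal.fact_isRegular_aleph0

variable {G : Type u} [Category.{v} G] [Abelian G] [IsLocallyCoherent G]

/-! Everything rests on effacement inside `fp G`. A morphism `F[-n] ⟶ X` that vanishes on `H^n` is
killed by some epimorphism `B ⟶ F` (`exists_epi_comp_eq_zero`). If `F` is finitely presented, `B`
can be replaced by a finitely presented object (`exists_fp_epi`), and the kernel is again finitely
presented by coherence (`exists_fp_effacement`). This allows dimension shifting without leaving `fp
G`.

If `X` lies in `D^b(fp G)`, then `X` is of type `FP_∞`: dimension shifting shows that `Ext^n(F, -)`
commutes with direct limits for `F` in `fp G` (`isHomColimit_single`), and the objects with this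
property, closed under shifts, form a triangulated subcategory, so dévissage applies.

Conversely, the top cohomology of an `FP_∞` object is finitely presented (`fpInfty.fp_of_triangle`).
Hence `X` can be resolved from the top by stalks of finitely presented objects
(`fpInfty.exists_triangle`). Once the resolution passes the lower bound of `X`, the error term is
itself a finitely presented stalk, and one more cone gives `X`.

For compactness, a coproduct in `D^b(G)` need not be known to commute with cohomology. Instead, the
idempotents `cofanIdem` projecting to finite subsums are used: maps into injective stalks show that
they are jointly epimorphic on each `H^n` (`eq_zero_of_homologyMap_cofanIdem_comp`). A map from a
finitely presented object to `H^n` is thus fixed by one of them (`exists_comp_eq_of_fp`), and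
dimension shifting down to the lower bound of the coproduct lifts this to morphisms in `D^b(G)`. -/

lemma exists_filtered_presentation (X : G) : ∃ (J : Type v) (_ : SmallCategory J)
    (_ : IsFiltered J), Nonempty ((fp G).ColimitOfShape J X) := by
  have := IsLocallyCoherent.locallyFinitelyPresentable (G := G)
  obtain ⟨P, _, hP⟩ := HasCardinalFilteredGenerator.exists_generator G Cardinal.aleph0.{v}
  obtain ⟨J, _, hJ, hX⟩ := hP.exists_colimitsOfShape X
  rw [isCardinalFiltered_aleph0_iff] at hJ
  obtain ⟨h⟩ := ObjectProperty.colimitsOfShape_monotone J hP.le_isCardinalPresentable _ hX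
  exact ⟨J, inferInstance, hJ, ⟨h⟩⟩

open ZeroObject in
-- Write `B` as a filtered colimit of finitely presented `B_j`. The cokernels of `B_j ⟶ A` have
-- colimit `coker p = 0`, so finite presentation of `A` makes the quotient map from `A` zero at some
-- stage `j`; there `B_j ⟶ A` is epi.
lemma exists_fp_epi {A B : G} (hA : fp G A) (p : B ⟶ A) [Epi p] :
    ∃ (P : G) (_ : fp G P) (q : P ⟶ B), Epi (q ≫ p) := by
  obtain ⟨J, _, _, ⟨h⟩⟩ := exists_filtered_presentation B
  have hA : IsFinitelyPresentable.{v} A := hA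
  let α : h.diag ⟶ (Functor.const J).obj A := h.ι ≫ (Functor.const J).map p
  let π (j : J) : A ⟶ (cokernel α).obj j := (cokernel.π α).app j
  have hπ (i j : J) (f : i ⟶ j) : π i ≫ (cokernel α).map f = π j := by
    simpa [π] using ((cokernel.π α).naturality f).symm
  have hαπ (j : J) : h.ι.app j ≫ p ≫ π j = 0 := by
    have : α.app j ≫ (cokernel.π α).app j = 0 := by
      rw [← NatTrans.comp_app, cokernel.condition, zero_app]
    simpa [α] using this
  have : ∀ j, Epi (π j) := fun j => inferInstanceAs (Epi ((cokernel.π α).app j))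
  let c : Cocone (cokernel α) := { pt := 0, ι := 0 }
  have hc : IsColimit c :=
    { desc := fun s => 0
      fac := fun s j => by
        -- Since `J` is filtered, any two indices map to a common one, so all stages induce the same
        -- morphism out of `A`.
        have hconst : ∀ i j, π i ≫ s.ι.app i = π j ≫ s.ι.app j := by
          have aux : ∀ {i j : J} (f : i ⟶ j), π i ≫ s.ι.app i = π j ≫ s.ι.app j := by
            intro i j f
            rw [← s.w f, ← hπ i j f, Category.assoc]
          intro i j
          rw [aux (IsFiltered.leftToMax i j), aux (IsFiltered.rightToMax i j)]
        have h₁ : π j ≫ s.ι.app j = 0 := by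
          rw [← cancel_epi p, comp_zero]
          apply h.isColimit.hom_ext
          intro i
          rw [hconst j i, comp_zero]
          have := hαπ i =≫ s.ι.app i
          simpa using this
        rw [comp_zero, ← cancel_epi (π j), h₁, comp_zero]
      uniq := fun s m _ => (isZero_zero G).eq_of_src _ _ }
  obtain ⟨j₀⟩ : Nonempty J := IsFiltered.nonempty
  obtain ⟨j, u, v, huv⟩ := IsFinitelyPresentable.exists_eq_of_isColimit hc (X := A)
    (π j₀) (0 : A ⟶ (cokernel α).obj j₀) (by simp [c])
  have h₀ : π j = 0 := by
    rwa [hπ, zero_comp] at huv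
  refine ⟨h.diag.obj j, h.prop_diag_obj j, h.ι.app j, ?_⟩
  have hk : IsColimit ((CokernelCofork.ofπ (π j) (by simpa [α] using hαπ j) :
      CokernelCofork (α.app j))) :=
    isColimitCoforkMapOfIsColimit' ((evaluation J G).obj j) (cokernel.condition α) (cokernelIsCokernel α)
  have : Epi (α.app j) := by
    apply Preadditive.epi_of_cancel_zero
    intro Z g hg
    obtain ⟨l, hl⟩ := CokernelCofork.IsColimit.desc' hk g hg
    rw [← hl]
    simp [h₀]
  simpa [α] using this

/-- A filtered colimit can be rewritten over a directed poset by a final functor. Lifting `𝟙 A`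
through such a presentation makes `A` a retract of a finitely presented object, so surjectivity of
the comparison map suffices. -/
lemma fp_of_directed {A : G}
    (hA : ∀ (I : Type v) [PartialOrder I] [IsDirectedOrder I] [Nonempty I] (M : I ⥤ G)
      (c : Cocone M), IsColimit c → ∀ f : A ⟶ c.pt, ∃ (i : I) (g : A ⟶ M.obj i),
        g ≫ c.ι.app i = f) : fp G A := by
  obtain ⟨J, _, _, ⟨h⟩⟩ := exists_filtered_presentation A
  obtain ⟨I, _, _, _, F, _⟩ := IsFiltered.exists_directed J
  obtain ⟨i, g, hg⟩ := hA I (F ⋙ h.diag) (h.cocone.whisker F)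
    ((Functor.Final.isColimitWhiskerEquiv F h.cocone).symm h.isColimit) (𝟙 A)
  have : IsFinitelyPresentable.{v} (h.diag.obj (F.obj i)) := h.prop_diag_obj _
  exact (show Retract A (h.diag.obj (F.obj i)) from ⟨g, h.ι.app (F.obj i), hg⟩).isCardinalPresentable
    Cardinal.aleph0

end Fp

end

/-! ### Morphisms from and to stalk complexes in the derived category -/

section
section Derived

open DerivedCategory Pretriangulated Triangulated DerivedCategory.TStructure

variable {C : Type u} [Category.{v} C] [Abelian C] [HasDerivedCategory.{w} C]

lemma exists_single_triangle {S : ShortComplex C} (hS : S.ShortExact) (n : ℤ) :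
    ∃ δ : (singleFunctor C n).obj S.X₃ ⟶ ((singleFunctor C n).obj S.X₁)⟦(1 : ℤ)⟧,
      Triangle.mk ((singleFunctor C n).map S.f) ((singleFunctor C n).map S.g) δ ∈
        distTriang (DerivedCategory C) :=
  ⟨_, triangleOfSES_distinguished
    (hS.map_of_exact (HomologicalComplex.single C (ComplexShape.up ℤ) n))⟩

/-- The morphism `F[-n] ⟶ K` in the derived category given by a cocycle `F ⟶ K.X n`. -/
def fromSingle {F : C} {K : CochainComplex C ℤ} {n : ℤ} (φ : F ⟶ K.X n)
    (hφ : φ ≫ K.d n (n + 1) = 0) : (singleFunctor C n).obj F ⟶ Q.obj K :=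
  Q.map (HomologicalComplex.mkHomFromSingle φ (fun k hk => by
    obtain rfl : n + 1 = k := hk
    exact hφ))

/-- The morphism `K ⟶ F[-n]` in the derived category given by a morphism `K.X n ⟶ F`
vanishing on coboundaries. -/
def toSingle {F : C} {K : CochainComplex C ℤ} {n : ℤ} (φ : K.X n ⟶ F)
    (hφ : K.d (n - 1) n ≫ φ = 0) : Q.obj K ⟶ (singleFunctor C n).obj F :=
  Q.map (HomologicalComplex.mkHomToSingle φ (fun i hi => by
    obtain rfl : i = n - 1 := by simpa [eq_sub_iff_add_eq] using hi
    exact hφ))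

lemma single_map_comp_fromSingle {P F : C} {K : CochainComplex C ℤ} {n : ℤ} (p : P ⟶ F)
    (φ : F ⟶ K.X n) (hφ : φ ≫ K.d n (n + 1) = 0) :
    (singleFunctor C n).map p ≫ fromSingle φ hφ = fromSingle (p ≫ φ) (by simp [hφ]) := by
  have h : (HomologicalComplex.single C (ComplexShape.up ℤ) n).map p ≫
      HomologicalComplex.mkHomFromSingle φ (fun k hk => by
        obtain rfl : n + 1 = k := hk
        exact hφ) =
      HomologicalComplex.mkHomFromSingle (p ≫ φ) (fun k hk => by
        obtain rfl : n + 1 = k := hk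
        simp [hφ]) := by
    apply HomologicalComplex.from_single_hom_ext
    simp [HomologicalComplex.mkHomFromSingle_f, HomologicalComplex.single_map_f_self]
  exact (Q.map_comp _ _).symm.trans (Q.congr_map h)

lemma fromSingle_eq_zero {F : C} {K : CochainComplex C ℤ} {m n : ℤ} (hm : m + 1 = n)
    (x : F ⟶ K.X m) : fromSingle (n := n) (x ≫ K.d m n) (by simp) = 0 := by
  let f : (HomologicalComplex.single C (ComplexShape.up ℤ) n).obj F ⟶ K :=
    HomologicalComplex.mkHomFromSingle (x ≫ K.d m n) (fun k hk => by simp)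
  refine Eq.trans (Q_map_eq_of_homotopy C (f := f) (g := 0) ?_) (Q.map_zero _ _)
  refine
    { hom := fun i j => if h : i = n ∧ j = m then
          (HomologicalComplex.singleObjXIsoOfEq _ n F i h.1).hom ≫ x ≫
            (K.XIsoOfEq h.2.symm).hom else 0
      zero := fun i j hij => dif_neg (by
        rintro ⟨rfl, rfl⟩
        exact hij hm)
      comm := fun i => ?_ }
  by_cases hi : i = n
  · subst hi
    rw [prevD_eq _ (show (ComplexShape.up ℤ).Rel m i from hm)]
    rw [dNext_eq _ (show (ComplexShape.up ℤ).Rel i (i + 1) from rfl)]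
    simp [f, HomologicalComplex.mkHomFromSingle_f, HomologicalComplex.singleObjXSelf]
  · exact (HomologicalComplex.isZero_single_obj_X _ _ _ _ hi).eq_of_src _ _

lemma toSingle_eq_zero {F : C} {K : CochainComplex C ℤ} {m n : ℤ} (hm : n + 1 = m)
    (x : K.X m ⟶ F) : toSingle (n := n) (K.d n m ≫ x) (by simp) = 0 := by
  let f : K ⟶ (HomologicalComplex.single C (ComplexShape.up ℤ) n).obj F :=
    HomologicalComplex.mkHomToSingle (K.d n m ≫ x) (by intros; simp)
  refine Eq.trans (Q_map_eq_of_homotopy C (f := f) (g := 0) ?_) (Q.map_zero _ _)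
  refine
    { hom := fun i j => if h : i = m ∧ j = n then
          (K.XIsoOfEq h.1).hom ≫ x ≫ (HomologicalComplex.singleObjXIsoOfEq _ n F j h.2).inv
            else 0
      zero := fun i j hij => dif_neg (by
        rintro ⟨rfl, rfl⟩
        exact hij hm)
      comm := fun i => ?_ }
  by_cases hi : i = n
  · subst hi
    rw [dNext_eq _ (show (ComplexShape.up ℤ).Rel i m from hm)]
    rw [prevD_eq _ (show (ComplexShape.up ℤ).Rel (i - 1) i from by simp)]
    simp [f, HomologicalComplex.mkHomToSingle_f, HomologicalComplex.singleObjXSelf]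
  · exact (HomologicalComplex.isZero_single_obj_X _ _ _ _ hi).eq_of_tgt _ _

/-- By calculus of fractions the morphism is an honest chain map followed by the inverse of a
quasi-isomorphism; the target of that chain map serves as the model `K` of `X`. -/
lemma exists_eq_fromSingle {F : C} {X : DerivedCategory C} {n : ℤ}
    (f : (singleFunctor C n).obj F ⟶ X) :
    ∃ (K : CochainComplex C ℤ) (e : Q.obj K ≅ X) (φ : F ⟶ K.X n) (hφ : φ ≫ K.d n (n + 1) = 0),
      f = fromSingle φ hφ ≫ e.hom := by
  obtain ⟨K, ⟨e⟩⟩ : ∃ K, Nonempty (X ≅ Q.obj K) := ⟨_, ⟨(Q.objObjPreimageIso X).symm⟩⟩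
  obtain ⟨L, g, s, _, hg⟩ := left_fac (X := (HomologicalComplex.single C _ n).obj F) (f ≫ e.hom)
  have hg₁ : (HomologicalComplex.singleObjXSelf _ n F).inv ≫ g.f n ≫ L.d n (n + 1) = 0 := by
    simp [g.comm]
  refine ⟨L, (asIso (Q.map s)).symm ≪≫ e.symm,
    (HomologicalComplex.singleObjXSelf _ n F).inv ≫ g.f n, by simp, ?_⟩
  have h₁ : fromSingle ((HomologicalComplex.singleObjXSelf _ n F).inv ≫ g.f n)
      (by simp) = Q.map g := by
    refine Q.congr_map ?_
    apply HomologicalComplex.from_single_hom_ext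
    rw [HomologicalComplex.mkHomFromSingle_f, Iso.hom_inv_id_assoc]
  have h₂ : f ≫ e.hom = fromSingle ((HomologicalComplex.singleObjXSelf _ n F).inv ≫ g.f n)
      (by simp) ≫ inv (Q.map s) := by
    rw [h₁]
    exact hg
  rw [← cancel_mono e.hom, h₂]
  simp

lemma exists_eq_toSingle {F : C} {X : DerivedCategory C} {n : ℤ}
    (f : X ⟶ (singleFunctor C n).obj F) :
    ∃ (K : CochainComplex C ℤ) (e : X ≅ Q.obj K) (φ : K.X n ⟶ F) (hφ : K.d (n - 1) n ≫ φ = 0),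
      f = e.hom ≫ toSingle φ hφ := by
  obtain ⟨K, ⟨e⟩⟩ : ∃ K, Nonempty (Q.obj K ≅ X) := ⟨_, ⟨(Q.objObjPreimageIso X)⟩⟩
  obtain ⟨L, s, _, g, hg⟩ := right_fac (Y := (HomologicalComplex.single C _ n).obj F) (e.hom ≫ f)
  have hg₁ : L.d (n - 1) n ≫ g.f n ≫ (HomologicalComplex.singleObjXSelf _ n F).hom = 0 := by
    rw [← Category.assoc, ← g.comm]
    simp
  refine ⟨L, e.symm ≪≫ (asIso (Q.map s)).symm,
    g.f n ≫ (HomologicalComplex.singleObjXSelf _ n F).hom, hg₁, ?_⟩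
  have h₁ : toSingle (g.f n ≫ (HomologicalComplex.singleObjXSelf _ n F).hom) hg₁ = Q.map g := by
    refine Q.congr_map ?_
    apply HomologicalComplex.to_single_hom_ext
    rw [HomologicalComplex.mkHomToSingle_f, Category.assoc, Iso.hom_inv_id, Category.comp_id]
  have h₂ : e.hom ≫ f = inv (Q.map s) ≫
      toSingle (g.f n ≫ (HomologicalComplex.singleObjXSelf _ n F).hom) hg₁ := by
    rw [h₁]
    exact hg
  rw [← cancel_epi e.hom, h₂]
  simp

/-- The homology of `Q.obj K` is the homology of `K`. -/
def homologyQIso (K : CochainComplex C ℤ) (n : ℤ) :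
    (homologyFunctor C n).obj (Q.obj K) ≅ K.homology n :=
  (homologyFunctorFactors C n).app K

lemma homologyQIso_hom_naturality {K L : CochainComplex C ℤ} (f : K ⟶ L) (n : ℤ) :
    (homologyFunctor C n).map (Q.map f) ≫ (homologyQIso L n).hom =
      (homologyQIso K n).hom ≫ HomologicalComplex.homologyMap f n :=
  homologyFunctorFactors_hom_naturality f n

/-- The homology in degree `n` of `F[-n]` is `F`. -/
def homologySingleIso (F : C) (n : ℤ) :
    (homologyFunctor C n).obj ((singleFunctor C n).obj F) ≅ F :=
  homologyQIso ((HomologicalComplex.single C (ComplexShape.up ℤ) n).obj F) n ≪≫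
    HomologicalComplex.singleObjHomologySelfIso _ _ F

lemma homologyMap_fromSingle {F : C} {K : CochainComplex C ℤ} {n : ℤ} (φ : F ⟶ K.X n)
    (hφ : φ ≫ K.d n (n + 1) = 0) :
    (homologyFunctor C n).map (fromSingle φ hφ) ≫ (homologyQIso K n).hom =
      (homologySingleIso F n).hom ≫ K.liftCycles φ (n + 1) (by simp) hφ ≫ K.homologyπ n := by
  have hφ' : ∀ k, (ComplexShape.up ℤ).Rel n k → φ ≫ K.d n k = 0 := fun k hk => by
    obtain rfl : n + 1 = k := hk
    exact hφ
  have h : HomologicalComplex.homologyMap (HomologicalComplex.mkHomFromSingle φ hφ') n =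
      (HomologicalComplex.singleObjHomologySelfIso _ n F).hom ≫
        K.liftCycles φ (n + 1) (by simp) hφ ≫ K.homologyπ n := by
    rw [← cancel_epi (HomologicalComplex.singleObjHomologySelfIso (ComplexShape.up ℤ) n F).inv,
      Iso.inv_hom_id_assoc, ← HomologicalComplex.singleObjCyclesSelfIso_inv_homologyπ,
      Category.assoc, HomologicalComplex.homologyπ_naturality, ← Category.assoc]
    congr 1
    rw [← cancel_mono (K.iCycles n)]
    simp [HomologicalComplex.mkHomFromSingle_f]
  refine (homologyQIso_hom_naturality (HomologicalComplex.mkHomFromSingle φ hφ') n).trans ?_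
  rw [h]
  exact (Category.assoc _ _ _).symm

lemma homologyMap_toSingle {F : C} {K : CochainComplex C ℤ} {n : ℤ} (φ : K.X n ⟶ F)
    (hφ : K.d (n - 1) n ≫ φ = 0) :
    (homologyFunctor C n).map (toSingle φ hφ) ≫ (homologySingleIso F n).hom =
      (homologyQIso K n).hom ≫ K.homologyι n ≫
        K.descOpcycles φ (n - 1) (by simp) hφ := by
  have hφ' : ∀ i, (ComplexShape.up ℤ).Rel i n → K.d i n ≫ φ = 0 := fun i hi => by
    obtain rfl : i = n - 1 := by simpa [eq_sub_iff_add_eq] using hi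
    exact hφ
  have h : HomologicalComplex.homologyMap (HomologicalComplex.mkHomToSingle φ hφ') n ≫
      (HomologicalComplex.singleObjHomologySelfIso _ n F).hom =
        K.homologyι n ≫ K.descOpcycles φ (n - 1) (by simp) hφ := by
    rw [← HomologicalComplex.homologyι_singleObjOpcyclesSelfIso_inv,
      HomologicalComplex.homologyι_naturality_assoc]
    congr 1
    rw [← cancel_epi (K.pOpcycles n)]
    simp [HomologicalComplex.mkHomToSingle_f]
  rw [← h]
  exact (reassoc_of% (homologyQIso_hom_naturality (HomologicalComplex.mkHomToSingle φ hφ') n)) _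

/-- A cocycle `F ⟶ K.X n` with zero class becomes a coboundary after pulling back along an
epimorphism, and then the chain map is null-homotopic. -/
lemma exists_epi_comp_eq_zero {F : C} {X : DerivedCategory C} {n : ℤ}
    (f : (singleFunctor C n).obj F ⟶ X) (hf : (homologyFunctor C n).map f = 0) :
    ∃ (P : C) (p : P ⟶ F) (_ : Epi p), (singleFunctor C n).map p ≫ f = 0 := by
  obtain ⟨K, e, φ, hφ, rfl⟩ := exists_eq_fromSingle f
  have h₀ : K.liftCycles φ (n + 1) (by simp) hφ ≫ K.homologyπ n = 0 := by
    rw [← cancel_epi (homologySingleIso F n).hom, ← homologyMap_fromSingle, comp_zero]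
    rw [Functor.map_comp, Preadditive.IsIso.comp_right_eq_zero] at hf
    rw [hf, zero_comp]
  obtain ⟨P, p, hp, x, hx⟩ :=
    (K.liftCycles_comp_homologyπ_eq_zero_iff_up_to_refinements (n - 1) n (n + 1)
      (by simp) (by simp) φ hφ).1 h₀
  refine ⟨P, p, hp, ?_⟩
  rw [← Category.assoc, single_map_comp_fromSingle]
  have : fromSingle (p ≫ φ) (by simp [hφ]) = 0 := by
    have := fromSingle_eq_zero (show n - 1 + 1 = n by lia) x
    simpa only [hx] using this
  rw [this, zero_comp]

/-- With the next lemma this says that `Hom(X, I[-n])` is `Hom(H^n X, I)`. A map from the opcycles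
that kills `H^n` extends to `K.X (n + 1)` by injectivity, which gives the null-homotopy. -/
lemma eq_zero_of_injective {I : C} [Injective I] {X : DerivedCategory C} {n : ℤ}
    (f : X ⟶ (singleFunctor C n).obj I) (hf : (homologyFunctor C n).map f = 0) : f = 0 := by
  obtain ⟨K, e, φ, hφ, rfl⟩ := exists_eq_toSingle f
  have h₀ : K.homologyι n ≫ K.descOpcycles φ (n - 1) (by simp) hφ = 0 := by
    rw [← cancel_epi (homologyQIso K n).hom, ← homologyMap_toSingle, comp_zero]
    rw [Functor.map_comp, Preadditive.IsIso.comp_left_eq_zero] at hf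
    rw [hf, zero_comp]
  have hS : (ShortComplex.mk (K.homologyι n) (K.fromOpcycles n (n + 1)) (by simp)).Exact :=
    ShortComplex.exact_of_f_is_kernel _ (K.homologyIsKernel n (n + 1) (by simp))
  let x := hS.descToInjective (K.descOpcycles φ (n - 1) (by simp) hφ) h₀
  have hx : K.d n (n + 1) ≫ x = φ := by
    have := hS.comp_descToInjective (K.descOpcycles φ (n - 1) (by simp) hφ) h₀
    dsimp at this
    rw [← K.p_fromOpcycles, Category.assoc, this, K.p_descOpcycles]
  have : toSingle φ hφ = 0 := by
    have := toSingle_eq_zero rfl x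
    simpa only [hx] using this
  rw [this, comp_zero]

lemma exists_homologyMap_eq_of_injective {I : C} [Injective I] {X : DerivedCategory C} {n : ℤ}
    (γ : (homologyFunctor C n).obj X ⟶ I) :
    ∃ g : X ⟶ (singleFunctor C n).obj I,
      (homologyFunctor C n).map g ≫ (homologySingleIso I n).hom = γ := by
  obtain ⟨K, ⟨e⟩⟩ : ∃ K, Nonempty (X ≅ Q.obj K) := ⟨_, ⟨(Q.objObjPreimageIso X).symm⟩⟩
  let ψ : K.opcycles n ⟶ I := Injective.factorThru
    ((homologyQIso K n).inv ≫ (homologyFunctor C n).map e.inv ≫ γ) (K.homologyι n)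
  refine ⟨e.hom ≫ toSingle (K.pOpcycles n ≫ ψ) (by simp), ?_⟩
  have h₁ : K.descOpcycles (K.pOpcycles n ≫ ψ) (n - 1) (by simp) (by simp) = ψ := by
    rw [← cancel_epi (K.pOpcycles n), K.p_descOpcycles]
  rw [Functor.map_comp, Category.assoc, homologyMap_toSingle, h₁, Injective.comp_factorThru,
    Iso.hom_inv_id_assoc, ← Functor.map_comp_assoc, e.hom_inv_id,
    CategoryTheory.Functor.map_id, Category.id_comp]

end Derived

end

/-! ### Hom into filtered systems: five lemma and dimension shifting -/

section
section HomColimit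

universe v₁ u₁ v₂ u₂ v₃ u₃

/-- For a cocone `c` on a filtered diagram `D`, the property that the
natural map from the colimit of `Hom(X, D i)` to `Hom(X, c)` is bijective. -/
structure IsHomColimit {T : Type u₁} [Category.{v₁} T] [HasZeroMorphisms T]
    {I : Type u₃} [Category.{v₃} I] {D : I ⥤ T} (c : Cocone D) (X : T) : Prop where
  exists_lift (f : X ⟶ c.pt) : ∃ (i : I) (g : X ⟶ D.obj i), g ≫ c.ι.app i = f
  exists_eq_zero {i : I} (g : X ⟶ D.obj i) (hg : g ≫ c.ι.app i = 0) :
    ∃ (j : I) (u : i ⟶ j), g ≫ D.map u = 0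

namespace IsHomColimit

section

variable {T : Type u₁} [Category.{v₁} T] [HasZeroMorphisms T]
    {T' : Type u₂} [Category.{v₂} T'] [HasZeroMorphisms T']
    {I : Type u₃} [Category.{v₃} I]

lemma of_iso {D : I ⥤ T} {c : Cocone D} {X Y : T} (h : IsHomColimit c X) (e : X ≅ Y) :
    IsHomColimit c Y where
  exists_lift f := by
    obtain ⟨i, g, hg⟩ := h.exists_lift (e.hom ≫ f)
    exact ⟨i, e.inv ≫ g, by rw [Category.assoc, hg, e.inv_hom_id_assoc]⟩
  exists_eq_zero {i} g hg := by
    obtain ⟨j, u, hu⟩ := h.exists_eq_zero (e.hom ≫ g) (by rw [Category.assoc, hg, comp_zero])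
    exact ⟨j, u, by rw [← cancel_epi e.hom, comp_zero, ← Category.assoc, hu]⟩

lemma mapCocone_iff (F : T ⥤ T') [F.Full] [F.Faithful] [F.PreservesZeroMorphisms]
    {D : I ⥤ T} (c : Cocone D) (X : T) :
    IsHomColimit (F.mapCocone c) (F.obj X) ↔ IsHomColimit c X := by
  constructor
  · intro h
    constructor
    · intro f
      obtain ⟨i, g, hg⟩ := h.exists_lift (F.map f)
      obtain ⟨g, rfl⟩ := F.map_surjective g
      exact ⟨i, g, F.map_injective (by simpa using hg)⟩
    · intro i g hg
      obtain ⟨j, u, hu⟩ := h.exists_eq_zero (i := i) (F.map g) (by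
        refine (F.map_comp _ _).symm.trans ?_
        rw [hg, F.map_zero])
      exact ⟨j, u, F.map_injective (by simpa using hu)⟩
  · intro h
    constructor
    · intro f
      obtain ⟨f, rfl⟩ := F.map_surjective f
      obtain ⟨i, g, hg⟩ := h.exists_lift f
      exact ⟨i, F.map g, by simp [← F.map_comp, hg]⟩
    · intro i g hg
      obtain ⟨g, rfl⟩ := F.map_surjective g
      obtain ⟨j, u, hu⟩ := h.exists_eq_zero (i := i) g (F.map_injective (by simpa using hg))
      exact ⟨j, u, by simp [← F.map_comp, hu]⟩

omit [HasZeroMorphisms T'] in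
lemma of_natIso {L L' : T' ⥤ T} (e : L ≅ L') {M : I ⥤ T'} {c : Cocone M} {X : T}
    (h : IsHomColimit (L.mapCocone c) X) : IsHomColimit (L'.mapCocone c) X where
  exists_lift f := by
    obtain ⟨i, g, hg⟩ := h.exists_lift (f ≫ e.inv.app _)
    refine ⟨i, g ≫ e.hom.app _, ?_⟩
    dsimp at hg ⊢
    rw [Category.assoc, ← e.hom.naturality, reassoc_of% hg]
    simp
  exists_eq_zero {i} g hg := by
    dsimp at g hg
    obtain ⟨j, u, hu⟩ := h.exists_eq_zero (i := i) (g ≫ e.inv.app _) (by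
      dsimp
      rw [Category.assoc, ← e.inv.naturality, reassoc_of% hg, zero_comp])
    dsimp at hu
    refine ⟨j, u, ?_⟩
    rw [Category.assoc, ← e.inv.naturality] at hu
    dsimp
    rw [← cancel_mono (e.inv.app _), zero_comp, Category.assoc, hu]

end

section

open Pretriangulated

variable {T : Type u₁} [Category.{v₁} T] [Preadditive T] [HasZeroObject T] [HasShift T ℤ]
  [∀ n : ℤ, (shiftFunctor T n).Additive] [Pretriangulated T]
  {I : Type u₃} [Category.{v₃} I] [IsFiltered I] {D : I ⥤ T} {c : Cocone D}

/-- The five lemma by diagram chase; the shifts of the outer terms are its outermost columns, and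
filteredness brings representatives to a common index. -/
lemma of_distTriang {Δ : Triangle T} (hΔ : Δ ∈ distTriang T) (h₁ : IsHomColimit c Δ.obj₁)
    (h₁' : IsHomColimit c (Δ.obj₁⟦(1 : ℤ)⟧)) (h₃ : IsHomColimit c Δ.obj₃)
    (h₃' : IsHomColimit c (Δ.obj₃⟦(-1 : ℤ)⟧)) : IsHomColimit c Δ.obj₂ where
  exists_lift f := by
    let t (i : I) : D.obj i ⟶ c.pt := c.ι.app i
    have ht {i j : I} (u : i ⟶ j) : D.map u ≫ t j = t i := c.w u
    obtain ⟨i, g, hg⟩ : ∃ i g, g ≫ t i = Δ.mor₁ ≫ f := h₁.exists_lift (Δ.mor₁ ≫ f)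
    let w : Δ.obj₃⟦(-1 : ℤ)⟧ ⟶ Δ.obj₁ := Δ.invRotate.mor₁
    have hw : w ≫ Δ.mor₁ = 0 := comp_distTriang_mor_zero₁₂ _ (inv_rot_of_distTriang _ hΔ)
    obtain ⟨j, u, hu⟩ := h₃'.exists_eq_zero (w ≫ g) (by
      refine (Category.assoc _ _ _).trans (Eq.trans (w ≫= hg) ?_)
      rw [reassoc_of% hw, zero_comp])
    obtain ⟨g', hg'⟩ : ∃ g' : Δ.obj₂ ⟶ D.obj j, g ≫ D.map u = Δ.mor₁ ≫ g' :=
      Triangle.yoneda_exact₂ _ (inv_rot_of_distTriang _ hΔ) (g ≫ D.map u)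
        ((Category.assoc _ _ _).symm.trans hu)
    obtain ⟨k, hk⟩ := Triangle.yoneda_exact₂ _ hΔ (f - g' ≫ t j) (by
      rw [Preadditive.comp_sub, ← hg, ← reassoc_of% hg', ht, sub_self])
    obtain ⟨l, k', hk'⟩ : ∃ l k', k' ≫ t l = k := h₃.exists_lift k
    refine ⟨IsFiltered.max j l, g' ≫ D.map (IsFiltered.leftToMax j l) +
      Δ.mor₂ ≫ k' ≫ D.map (IsFiltered.rightToMax j l), ?_⟩
    change _ ≫ t _ = _
    simp only [Preadditive.add_comp, Category.assoc, ht, hk', ← hk]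
    abel
  exists_eq_zero {i} g hg := by
    obtain ⟨j, u, hu⟩ := h₁.exists_eq_zero (Δ.mor₁ ≫ g) (by
      rw [Category.assoc, hg, comp_zero])
    obtain ⟨k, hk⟩ := Triangle.yoneda_exact₂ _ hΔ (g ≫ D.map u) (by
      rw [← Category.assoc]; exact hu)
    obtain ⟨l, hl⟩ := Triangle.yoneda_exact₃ _ hΔ (k ≫ c.ι.app j) (by
      rw [← reassoc_of% hk, c.w, hg])
    obtain ⟨m, l', hl'⟩ := h₁'.exists_lift l
    obtain ⟨p, v, hv⟩ := h₃.exists_eq_zero (k ≫ D.map (IsFiltered.leftToMax j m) -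
        Δ.mor₃ ≫ l' ≫ D.map (IsFiltered.rightToMax j m)) (by
      simp only [Preadditive.sub_comp, Category.assoc, c.w, hl', hl, sub_self])
    refine ⟨p, u ≫ IsFiltered.leftToMax j m ≫ v, ?_⟩
    have h₂₃ := comp_distTriang_mor_zero₂₃ _ hΔ
    have hv' := Δ.mor₂ ≫= hv
    simp only [Preadditive.sub_comp, Preadditive.comp_sub, Category.assoc,
      reassoc_of% h₂₃, zero_comp, sub_zero, comp_zero] at hv'
    rw [D.map_comp, D.map_comp, reassoc_of% hk, hv']

/-- Dimension shifting: an effaced morphism factors through `d : Z ⟶ A⟦1⟧`, and its factorization is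
unique up to morphisms coming from `B⟦1⟧`. In the application `A⟦1⟧` and `B⟦1⟧` are stalks one
degree lower than `Z`. -/
lemma of_effaceable {Z : T}
    (h : ∀ (Y : T), (Y = c.pt ∨ ∃ i, Y = D.obj i) → ∀ (f : Z ⟶ Y),
      ∃ (A B : T) (a : A ⟶ B) (b : B ⟶ Z) (d : Z ⟶ A⟦(1 : ℤ)⟧),
        Triangle.mk a b d ∈ distTriang T ∧ b ≫ f = 0 ∧ IsHomColimit c (A⟦(1 : ℤ)⟧) ∧
          IsHomColimit c (B⟦(1 : ℤ)⟧)) : IsHomColimit c Z where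
  exists_lift f := by
    obtain ⟨A, B, a, b, d, hΔ, hf, hA, -⟩ := h _ (Or.inl rfl) f
    obtain ⟨y, rfl⟩ : ∃ y : A⟦(1 : ℤ)⟧ ⟶ c.pt, f = d ≫ y := Triangle.yoneda_exact₃ _ hΔ f hf
    obtain ⟨i, y', rfl⟩ := hA.exists_lift y
    exact ⟨i, d ≫ y', Category.assoc _ _ _⟩
  exists_eq_zero {i} g hg := by
    let t (i : I) : D.obj i ⟶ c.pt := c.ι.app i
    have ht {i j : I} (u : i ⟶ j) : D.map u ≫ t j = t i := c.w u
    obtain ⟨A, B, a, b, d, hΔ, hgb, hA, hB⟩ := h _ (Or.inr ⟨i, rfl⟩) g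
    obtain ⟨y, rfl⟩ : ∃ y : A⟦(1 : ℤ)⟧ ⟶ D.obj i, g = d ≫ y :=
      Triangle.yoneda_exact₃ _ hΔ g hgb
    have hda : d ≫ a⟦(1 : ℤ)⟧' = 0 := comp_distTriang_mor_zero₃₁ _ hΔ
    obtain ⟨z, hz⟩ : ∃ z : B⟦(1 : ℤ)⟧ ⟶ c.pt, y ≫ t i = (-a⟦(1 : ℤ)⟧') ≫ z :=
      Triangle.yoneda_exact₃ _ (rot_of_distTriang _ hΔ) (y ≫ t i)
        ((Category.assoc _ _ _).symm.trans hg)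
    obtain ⟨j, z', hz'⟩ : ∃ j z', z' ≫ t j = z := hB.exists_lift z
    obtain ⟨k, u, hu⟩ := hA.exists_eq_zero (y ≫ D.map (IsFiltered.leftToMax i j) -
        (-a⟦(1 : ℤ)⟧') ≫ z' ≫ D.map (IsFiltered.rightToMax i j)) (by
      change _ ≫ t _ = 0
      simp only [Preadditive.sub_comp, Category.assoc, ht, hz', hz, sub_self])
    refine ⟨k, IsFiltered.leftToMax i j ≫ u, ?_⟩
    have hu' := d ≫= hu
    simp only [Preadditive.sub_comp, Preadditive.comp_sub, Preadditive.neg_comp,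
      Preadditive.comp_neg, Category.assoc, reassoc_of% hda, zero_comp, sub_zero, comp_zero,
      neg_zero] at hu'
    rw [D.map_comp, Category.assoc, hu']

variable (c) in
/-- The objects `X` such that `X⟦n⟧` satisfies `IsHomColimit c` for all `n`. -/
def shiftClosure : ObjectProperty T := fun X => ∀ n : ℤ, IsHomColimit c (X⟦n⟧)

instance : (shiftClosure c).IsClosedUnderIsomorphisms where
  of_iso e h n := (h n).of_iso ((shiftFunctor T n).mapIso e)

open ZeroObject in
instance [Nonempty I] : (shiftClosure c).IsTriangulated where
  exists_zero := ⟨0, isZero_zero T, fun n =>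
    { exists_lift := fun _ => ⟨Classical.arbitrary I, 0,
        (((shiftFunctor T n).map_isZero (isZero_zero T)).eq_of_src _ _)⟩
      exists_eq_zero := fun {i} _ _ => ⟨i, 𝟙 _,
        (((shiftFunctor T n).map_isZero (isZero_zero T)).eq_of_src _ _)⟩ }⟩
  isStableUnderShiftBy a :=
    { le_shift := fun X hX n => (hX (a + n)).of_iso ((shiftFunctorAdd T a n).app X) }
  ext₂' _ hΔ h₁ h₃ := ObjectProperty.le_isoClosure _ _ (fun n =>
    of_distTriang (Triangle.shift_distinguished _ hΔ n) (h₁ n)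
      ((h₁ (n + 1)).of_iso ((shiftFunctorAdd T n 1).app _)) (h₃ n)
      ((h₃ (n + -1)).of_iso ((shiftFunctorAdd T n (-1)).app _)))

end

end IsHomColimit

end HomColimit

end

/-! ### Ext from finitely presented objects commutes with direct limits -/

section
open DerivedCategory Pretriangulated Triangulated DerivedCategory.TStructure

variable {G : Type u} [Category.{v} G] [Abelian G] [IsLocallyCoherent G]
  [HasDerivedCategory.{w₁} G]

lemma exists_fp_effacement {F : G} (hF : fp G F) {X : DerivedCategory G} {n : ℤ}
    (f : (singleFunctor G n).obj F ⟶ X) (hf : (homologyFunctor G n).map f = 0) :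
    ∃ (F' P : G) (_ : fp G F') (_ : fp G P) (i : F' ⟶ P) (p : P ⟶ F) (_ : Epi p)
      (d : (singleFunctor G n).obj F ⟶ ((singleFunctor G n).obj F')⟦(1 : ℤ)⟧),
      Triangle.mk ((singleFunctor G n).map i) ((singleFunctor G n).map p) d ∈ distTriang _ ∧
        (singleFunctor G n).map p ≫ f = 0 := by
  obtain ⟨B, p, _, hp⟩ := exists_epi_comp_eq_zero f hf
  obtain ⟨P, hP, q, hq⟩ := exists_fp_epi hF p
  have hS : (ShortComplex.mk (kernel.ι (q ≫ p)) (q ≫ p) (kernel.condition _)).ShortExact :=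
    { exact := ShortComplex.exact_kernel _ }
  obtain ⟨d, hd⟩ := exists_single_triangle hS n
  refine ⟨kernel (q ≫ p), P, (fp G).prop_kernel _ hP hF, hP, kernel.ι _, q ≫ p, hq, d, hd, ?_⟩
  rw [Functor.map_comp, Category.assoc, hp, comp_zero]

/-- The Hom groups here are `Ext^n(F, M i)`. They vanish for `n < 0`, finite presentation settles `n
= 0`, and for larger `n` every class is effaceable because `H^n` of a stalk in degree `0` is zero.
-/
lemma isHomColimit_single {I : Type v} [SmallCategory I] [IsFiltered I] {M : I ⥤ G}
    {c : Cocone M} (hc : IsColimit c) (n : ℤ) {F : G} (hF : fp G F) :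
    IsHomColimit ((singleFunctor G 0).mapCocone c) ((singleFunctor G n).obj F) := by
  by_cases hn : n < 0
  · have h₀ {X : G} (f : (singleFunctor G n).obj F ⟶ (singleFunctor G 0).obj X) : f = 0 :=
      t.zero f n 0
    exact
      { exists_lift := fun f => ⟨IsFiltered.nonempty.some, 0, by rw [zero_comp, h₀ f]⟩
        exists_eq_zero := fun {i} g _ => ⟨i, 𝟙 _, by rw [h₀ g, zero_comp]⟩ }
  obtain ⟨n, rfl⟩ := Int.eq_ofNat_of_zero_le (not_lt.1 hn)
  clear hn
  induction n generalizing F with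
  | zero =>
    refine (IsHomColimit.mapCocone_iff (singleFunctor G 0) c F).2 ?_
    have hF : IsFinitelyPresentable.{v} F := hF
    exact
      { exists_lift := fun f => IsFinitelyPresentable.exists_hom_of_isColimit hc f
        exists_eq_zero := fun {i} g hg => by
          obtain ⟨j, u, v, huv⟩ := IsFinitelyPresentable.exists_eq_of_isColimit hc
            g (0 : F ⟶ M.obj i) (by rw [hg, zero_comp])
          exact ⟨j, u, by rw [huv, zero_comp]⟩ }
  | succ n hn =>
    apply IsHomColimit.of_effaceable
    intro Y hY f
    have hY' : IsZero ((homologyFunctor G (n + 1 : ℕ)).obj Y) := by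
      obtain ⟨X, rfl⟩ : ∃ X : G, Y = (singleFunctor G 0).obj X := by
        obtain rfl | ⟨i, rfl⟩ := hY
        · exact ⟨_, rfl⟩
        · exact ⟨_, rfl⟩
      exact isZero_of_isLE _ 0 _ (by positivity)
    obtain ⟨F', P, hF', hP, i, p, _, d, hd, h⟩ := exists_fp_effacement hF f (hY'.eq_of_tgt _ _)
    exact ⟨_, _, _, _, d, hd, h,
      (hn hF').of_iso (((singleFunctors G).shiftIso 1 n (n + 1 : ℕ) (by push_cast; ring)).symm.app _),
      (hn hP).of_iso (((singleFunctors G).shiftIso 1 n (n + 1 : ℕ) (by push_cast; ring)).symm.app _)⟩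

lemma shiftClosure_single {I : Type v} [SmallCategory I] [IsFiltered I] {M : I ⥤ G}
    {c : Cocone M} (hc : IsColimit c) (n : ℤ) {F : G} (hF : fp G F) :
    IsHomColimit.shiftClosure ((singleFunctor G 0).mapCocone c) ((singleFunctor G n).obj F) :=
  fun a => (isHomColimit_single hc (n - a) hF).of_iso
    (((singleFunctors G).shiftIso a (n - a) n (by ring)).symm.app _)

end

/-! ### Dévissage, and objects of `D^b(fp G)` are of type `FP_∞` -/

section
open DerivedCategory Pretriangulated Triangulated DerivedCategory.TStructure

section

variable {C : Type u} [Category.{v} C] [Abelian C] [HasDerivedCategory.{w} C]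

lemma isLE₃ {X Y Z : DerivedCategory C} {f : X ⟶ Y} {g : Y ⟶ Z} {h : Z ⟶ X⟦(1 : ℤ)⟧}
    (hT : Triangle.mk f g h ∈ distTriang _) (n : ℤ) (hX : t.IsLE X (n + 1)) (hY : t.IsLE Y n) :
    t.IsLE Z n :=
  t.isLE₂ _ (rot_of_distTriang _ hT) n hY (t.isLE_shift X (n + 1) 1 n)

lemma isGE₁ {X Y Z : DerivedCategory C} {f : X ⟶ Y} {g : Y ⟶ Z} {h : Z ⟶ X⟦(1 : ℤ)⟧}
    (hT : Triangle.mk f g h ∈ distTriang _) (n : ℤ) (hY : t.IsGE Y n)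
    (hZ : t.IsGE Z (n - 1)) : t.IsGE X n :=
  t.isGE₂ _ (inv_rot_of_distTriang _ hT) n (t.isGE_shift Z (n - 1) (-1) n) hY

lemma prop_of_bounded (P : ObjectProperty (DerivedCategory C)) [P.IsClosedUnderIsomorphisms]
    [P.IsTriangulated] (hP : ∀ (n : ℤ) (F : C), P ((singleFunctor C n).obj F))
    {X : DerivedCategory C} (hX : t.bounded X) : P X := by
  obtain ⟨⟨a, _⟩, ⟨b, hb⟩⟩ := hX
  obtain ⟨k, hk⟩ : ∃ k : ℕ, b < a + k := ⟨(b + 1 - a).toNat, by lia⟩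
  have : t.IsLE X (a + k - 1) := t.isLE_of_le X b _
  clear hb hk
  induction k generalizing X with
  | zero => exact P.prop_of_isZero (t.isZero X (a + (0 : ℕ) - 1) a)
  | succ k hk =>
    obtain ⟨L, R, hL, hR, f, g, h, hT⟩ := t.exists_triangle X (a + k - 1) (a + k) (by ring)
    have : t.IsLE L (a + k - 1) := ⟨hL⟩
    have : t.IsGE R (a + k) := ⟨hR⟩
    have : t.IsLE R (a + k) := isLE₃ hT _ (t.isLE_of_le _ (a + k - 1) _)
      (t.isLE_of_le X (a + (k + 1 : ℕ) - 1) _)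
    have : t.IsGE L a := isGE₁ hT a inferInstance (t.isGE_of_ge _ _ (a + k))
    obtain ⟨F, ⟨e⟩⟩ := exists_iso_singleFunctor_obj_of_isGE_of_isLE R (a + k)
    exact P.ext_of_isTriangulatedClosed₂ _ hT (hk (X := L) inferInstance inferInstance)
      (P.prop_of_iso e.symm (hP _ _))

end

variable {G : Type u} [Category.{v} G] [Abelian G]

section

variable [HasDerivedCategory.{w₁} G]

open Classical in
lemma homDirectLimitMap_bijective_iff {T : Type u} [Category.{w} T] [Preadditive T] (X : T)
    {I : Type v} [PartialOrder I] [IsDirectedOrder I] [Nonempty I] {D : I ⥤ T} (c : Cocone D) :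
    Function.Bijective (homDirectLimitMap X c) ↔ IsHomColimit c X := by
  let f (i j : I) (h : i ≤ j) : (X ⟶ D.obj i) →+ (X ⟶ D.obj j) := postcomp X (D.map (homOfLE h))
  have : DirectedSystem (fun i => X ⟶ D.obj i) (fun i j h => f i j h) :=
    { map_self := fun i x => by simp [f, postcomp, Preadditive.rightComp]
      map_map := fun i j k hij hjk x => by
        simp [f, postcomp, Preadditive.rightComp, ← D.map_comp] }
  have hof (i : I) (x : X ⟶ D.obj i) :
      homDirectLimitMap X c (AddCommGroup.DirectLimit.of _ f i x) = x ≫ c.ι.app i :=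
    AddCommGroup.DirectLimit.lift_of _ _ _ _ _
  constructor
  · rintro ⟨hinj, hsurj⟩
    constructor
    · intro y
      obtain ⟨z, rfl⟩ := hsurj y
      induction z using AddCommGroup.DirectLimit.induction_on with
      | ih i x => exact ⟨i, x, (hof i x).symm⟩
    · intro i g hg
      obtain ⟨j, hij, h⟩ := AddCommGroup.DirectLimit.of.zero_exact (f := f) i g
        (hinj (by rw [hof, hg, map_zero]))
      exact ⟨j, homOfLE hij, h⟩
  · intro h
    constructor
    · rw [injective_iff_map_eq_zero]
      intro z hz
      induction z using AddCommGroup.DirectLimit.induction_on with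
      | ih i x =>
        obtain ⟨j, u, hu⟩ := h.exists_eq_zero x ((hof i x).symm.trans hz)
        have := AddCommGroup.DirectLimit.of_f (f := f) (leOfHom u) x
        rw [← this]
        exact (congrArg _ hu).trans (map_zero _)
    · intro y
      obtain ⟨i, x, hx⟩ := h.exists_lift y
      exact ⟨_, (hof i x).trans hx⟩

/-- The functor `stalk G` composed with shifts and the inclusion in the derived category. -/
def stalkShiftIso (n : ℤ) : (stalk G ⋙ shiftFunctor (Bounded G) n) ⋙ Bounded.ι ≅
    singleFunctor G 0 ⋙ shiftFunctor (DerivedCategory G) n :=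
  Functor.isoWhiskerLeft (stalk G) (Bounded.ι.commShiftIso n)

lemma isFPInfty_iff (X : Bounded G) :
    IsFPInfty X ↔ ∀ (I : Type v) [PartialOrder I] [IsDirectedOrder I] [Nonempty I] (M : I ⥤ G)
      (c : Cocone M), IsColimit c →
        IsHomColimit.shiftClosure ((singleFunctor G 0).mapCocone c) X.obj := by
  refine forall_congr' fun I => forall_congr' fun _ => forall_congr' fun _ => forall_congr' fun _ =>
    forall_congr' fun M => forall_congr' fun c => forall_congr' fun _ => ?_
  -- `Hom(X, M[-n])` is `Hom(X[n], M)`, hence the change of sign.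
  rw [(Equiv.neg ℤ).forall_congr_left, IsHomColimit.shiftClosure]
  refine forall_congr' fun n => ?_
  rw [homDirectLimitMap_bijective_iff, ← IsHomColimit.mapCocone_iff Bounded.ι]
  have e : X.obj ≅ (shiftFunctor (DerivedCategory G) (-n)).obj (X.obj⟦n⟧) :=
    (shiftFunctorCompIsoId (DerivedCategory G) n (-n) (by simp)).symm.app X.obj
  have h := IsHomColimit.mapCocone_iff (shiftFunctor (DerivedCategory G) (-n))
    ((singleFunctor G 0).mapCocone c) (X.obj⟦n⟧)
  constructor
  · intro h'
    exact h.1 ((IsHomColimit.of_natIso (c := c) (stalkShiftIso (-n)) (X := X.obj) h').of_iso e)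
  · intro h'
    exact IsHomColimit.of_natIso (c := c) (stalkShiftIso (-n)).symm
      (IsHomColimit.of_iso (h.2 h') e.symm)

end

section

variable [HasDerivedCategory.{w₁} G] [IsLocallyCoherent G] [HasDerivedCategory.{w₂} (Fp G)]

lemma prop_mapDerivedCategory_of_bounded (P : ObjectProperty (DerivedCategory G))
    [P.IsClosedUnderIsomorphisms] [P.IsTriangulated]
    (hP : ∀ (n : ℤ) (F : G), fp G F → P ((singleFunctor G n).obj F))
    {X : DerivedCategory (Fp G)} (hX : t.bounded X) : P ((fp G).ι.mapDerivedCategory.obj X) := by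
  exact prop_of_bounded (P.inverseImage (fp G).ι.mapDerivedCategory) (fun n F =>
    P.prop_of_iso (((fp G).ι.mapDerivedCategorySingleFunctor n).symm.app F)
      (hP n F.obj F.property)) hX

lemma isFPInfty_of_boundedFp {X : Bounded G} (hX : boundedFp.{w₁, w₂} G X) : IsFPInfty X := by
  rw [isFPInfty_iff]
  intro I _ _ _ M c hc
  obtain ⟨K, ⟨e⟩⟩ := hX
  exact ObjectProperty.prop_of_iso _ (Bounded.ι.mapIso e)
    (prop_mapDerivedCategory_of_bounded _ (fun n F hF => shiftClosure_single hc n hF) K.property)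

end

end

/-! ### Objects of type `FP_∞` lie in `D^b(fp G)` -/

section
open DerivedCategory Pretriangulated Triangulated DerivedCategory.TStructure

open ZeroObject

lemma distTriang_of_isos {T : Type u} [Category.{v} T] [Preadditive T] [HasZeroObject T]
    [HasShift T ℤ] [∀ n : ℤ, (shiftFunctor T n).Additive] [Pretriangulated T]
    {X X' Y Z Z' : T} {f : X ⟶ Y} {g : Y ⟶ Z} {h : Z ⟶ X⟦(1 : ℤ)⟧}
    (hT : Triangle.mk f g h ∈ distTriang T) (e : X' ≅ X) (e' : Z ≅ Z') :
    Triangle.mk (e.hom ≫ f) (g ≫ e'.hom) (e'.inv ≫ h ≫ e.inv⟦(1 : ℤ)⟧') ∈ distTriang T := by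
  refine isomorphic_distinguished _ hT _ (Triangle.isoMk _ _ e (Iso.refl Y) e'.symm ?_ ?_ ?_)
  · change (e.hom ≫ f) ≫ 𝟙 Y = e.hom ≫ f
    simp
  · change (g ≫ e'.hom) ≫ e'.inv = 𝟙 Y ≫ g
    simp
  · change (e'.inv ≫ h ≫ e.inv⟦(1 : ℤ)⟧') ≫ e.hom⟦(1 : ℤ)⟧' = e'.inv ≫ h
    simp [← Functor.map_comp]

section

variable {C : Type u} [Category.{v} C] [Abelian C] [HasDerivedCategory.{w} C]

lemma exists_triangle_single (X : DerivedCategory C) (n : ℤ) (hX : t.IsLE X n) :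
    ∃ (L : DerivedCategory C) (_ : t.IsLE L (n - 1)) (A : C) (a : L ⟶ X)
      (q : X ⟶ (singleFunctor C n).obj A) (d : (singleFunctor C n).obj A ⟶ L⟦(1 : ℤ)⟧),
      Triangle.mk a q d ∈ distTriang _ := by
  obtain ⟨L, R, hL, hR, f, g, h, hT⟩ := t.exists_triangle X (n - 1) n (by ring)
  have hL : t.IsLE L (n - 1) := ⟨hL⟩
  have : t.IsGE R n := ⟨hR⟩
  have : t.IsLE R n := isLE₃ hT _ (t.isLE_of_le _ (n - 1) _) hX
  obtain ⟨A, ⟨e⟩⟩ := exists_iso_singleFunctor_obj_of_isGE_of_isLE R n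
  exact ⟨L, hL, A, _, _, _, distTriang_of_isos hT (Iso.refl L) e⟩

end

variable {G : Type u} [Category.{v} G] [Abelian G] [HasDerivedCategory.{w₁} G]

variable (G) in
/-- The objects of `D(G)` of type `FP_∞`. -/
def fpInfty : ObjectProperty (DerivedCategory G) := fun X =>
  ∀ (I : Type v) [PartialOrder I] [IsDirectedOrder I] [Nonempty I] (M : I ⥤ G)
    (c : Cocone M), IsColimit c →
      IsHomColimit.shiftClosure ((singleFunctor G 0).mapCocone c) X

instance : (fpInfty G).IsClosedUnderIsomorphisms where
  of_iso e h I _ _ _ M c hc := ObjectProperty.prop_of_iso _ e (h I M c hc)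

instance : (fpInfty G).IsTriangulated where
  exists_zero := ⟨_, isZero_zero _, fun _ _ _ _ _ _ _ => ObjectProperty.prop_zero _⟩
  isStableUnderShiftBy a :=
    { le_shift := fun _ hX I _ _ _ M c hc => ObjectProperty.le_shift _ a _ (hX I M c hc) }
  ext₂' T hT h₁ h₃ := ObjectProperty.le_isoClosure _ _ (fun I _ _ _ M c hc =>
    ObjectProperty.ext_of_isTriangulatedClosed₂ _ T hT (h₁ I M c hc) (h₃ I M c hc))

lemma fpInfty.isHomColimit {X : DerivedCategory G} (hX : fpInfty G X) {I : Type v}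
    [PartialOrder I] [IsDirectedOrder I] [Nonempty I] {M : I ⥤ G} {c : Cocone M}
    (hc : IsColimit c) (n : ℤ) : IsHomColimit ((singleFunctor G n).mapCocone c) X :=
  (IsHomColimit.mapCocone_iff (shiftFunctor (DerivedCategory G) n)
    ((singleFunctor G n).mapCocone c) X).1
      (IsHomColimit.of_natIso (c := c) ((singleFunctors G).shiftIso n 0 n (by simp)).symm
        (hX I M c hc n))

variable [IsLocallyCoherent G]

/-- Here `A` is the top cohomology of `X`. Neither `L` nor `L⟦1⟧` has nonzero maps to stalks in
degree `n`, so `Hom(A, N)` is `Hom(X, N[-n])` for every `N` in `G`, and liftings descend from `X` to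
`A`. -/
lemma fpInfty.fp_of_triangle {X L : DerivedCategory G} (hX : fpInfty G X) {n : ℤ}
    (hL : t.IsLE L (n - 1)) {A : G} {a : L ⟶ X} {q : X ⟶ (singleFunctor G n).obj A}
    {d : (singleFunctor G n).obj A ⟶ L⟦(1 : ℤ)⟧} (hT : Triangle.mk a q d ∈ distTriang _) :
    fp G A := by
  apply fp_of_directed
  intro I _ _ _ M c hc f
  obtain ⟨i, g, hg⟩ : ∃ (i : I) (g : X ⟶ (singleFunctor G n).obj (M.obj i)),
    g ≫ (singleFunctor G n).map (c.ι.app i) = q ≫ (singleFunctor G n).map f :=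
      (hX.isHomColimit hc n).exists_lift (q ≫ (singleFunctor G n).map f)
  obtain ⟨g, rfl⟩ : ∃ g', g = q ≫ g' := Triangle.yoneda_exact₂ _ hT g (t.zero (a ≫ g) (n - 1) n)
  obtain ⟨g, rfl⟩ := (singleFunctor G n).map_surjective g
  refine ⟨i, g, (singleFunctor G n).map_injective ?_⟩
  let ι : M.obj i ⟶ c.pt := c.ι.app i
  change (singleFunctor G n).map (g ≫ ι) = _
  rw [← sub_eq_zero, ← Functor.map_sub]
  obtain ⟨k, hk⟩ : ∃ k : L⟦(1 : ℤ)⟧ ⟶ _, (singleFunctor G n).map (g ≫ ι - f) = d ≫ k :=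
    Triangle.yoneda_exact₃ _ hT _ (by
      change q ≫ _ = 0
      rw [Functor.map_sub, Functor.map_comp, Preadditive.comp_sub, ← hg, Category.assoc, sub_self])
  have : t.IsLE (L⟦(1 : ℤ)⟧) (n - 2) := t.isLE_shift L (n - 1) 1 (n - 2)
  have hk₀ : k = 0 := t.zero k (n - 2) n
  rw [hk, hk₀, comp_zero]

/-- A finitely presented cover `P ⟶ A` of the top cohomology can be chosen to kill the obstruction
`d`, so it lifts to `X`. -/
lemma fpInfty.exists_approximation {X : DerivedCategory G} (hX : fpInfty G X) {n : ℤ}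
    (hXn : t.IsLE X n) :
    ∃ (P : G) (_ : fp G P) (Y : DerivedCategory G) (_ : t.IsLE Y (n - 1))
      (p : (singleFunctor G n).obj P ⟶ X) (r : X ⟶ Y)
      (s : Y ⟶ ((singleFunctor G n).obj P)⟦(1 : ℤ)⟧), Triangle.mk p r s ∈ distTriang _ := by
  obtain ⟨L, hL, A, a, q, d, hT⟩ := exists_triangle_single X n hXn
  have hA := hX.fp_of_triangle hL hT
  have hL' : t.IsLE (L⟦(1 : ℤ)⟧) (n - 2) := t.isLE_shift L (n - 1) 1 (n - 2)
  obtain ⟨F', P, hF', hP, i, π, _, δ, hδ, hπ⟩ := exists_fp_effacement hA d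
    ((isZero_of_isLE _ (n - 2) n (by lia)).eq_of_tgt _ _)
  obtain ⟨p, hp⟩ : ∃ p, (singleFunctor G n).map π = p ≫ q :=
    Triangle.coyoneda_exact₃ _ hT _ hπ
  obtain ⟨Y, r, s, hY⟩ := distinguished_cocone_triangle p
  -- The octahedron for `π = p ≫ q` places `Y` between `L` and the stalk of the kernel `F'` in
  -- degree `n - 1`, which bounds `Y`.
  have h := someOctahedron hp.symm hY (rot_of_distTriang _ hT) (rot_of_distTriang _ hδ)
  refine ⟨P, hP, Y, ?_, p, r, s, hY⟩
  exact t.isLE₂ _ (inv_rot_of_distTriang _ h.mem) (n - 1)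
    (t.isLE_shift (L⟦(1 : ℤ)⟧) (n - 2) (-1) (n - 1))
    (t.isLE_shift ((singleFunctor G n).obj F') n 1 (n - 1))

section

variable [HasDerivedCategory.{w₂} (Fp G)]

instance isGE_mapDerivedCategory_obj (K : DerivedCategory (Fp G)) (n : ℤ) [h : t.IsGE K n] :
    t.IsGE ((fp G).ι.mapDerivedCategory.obj K) n := by
  obtain ⟨K', e, hK⟩ := h.ge
  exact ⟨_, (fp G).ι.mapDerivedCategory.mapIso e ≪≫ (fp G).ι.mapDerivedCategoryFactors.app K',
    (CochainComplex.isStrictlyGE_mapHomologicalComplex_obj_iff K' (fp G).ι n).2 hK⟩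

/-- The stalk complex of a finitely presented object comes from the derived category of `fp G`. -/
def singleIsoMapDerivedCategory {P : G} (hP : fp G P) (n : ℤ) :
    (singleFunctor G n).obj P ≅
      (fp G).ι.mapDerivedCategory.obj ((singleFunctor (Fp G) n).obj ⟨P, hP⟩) :=
  ((fp G).ι.mapDerivedCategorySingleFunctor n).symm.app ⟨P, hP⟩

/-- As `K` starts in degree `n`, such a morphism only sees `H^n K`, where fullness of `fp G` in `G`
applies. No fullness of the functor between derived categories is needed. -/
lemma exists_lift_of_isGE {P : G} (hP : fp G P) {n : ℤ} {K : DerivedCategory (Fp G)}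
    (hK : t.IsGE K n) (f : (singleFunctor G n).obj P ⟶ (fp G).ι.mapDerivedCategory.obj K) :
    ∃ f' : (singleFunctor (Fp G) n).obj ⟨P, hP⟩ ⟶ K,
      f = (singleIsoMapDerivedCategory hP n).hom ≫ (fp G).ι.mapDerivedCategory.map f' := by
  obtain ⟨L, R, hL, hR, a, b, c, hT⟩ := t.exists_triangle K n (n + 1) rfl
  have : t.IsLE L n := ⟨hL⟩
  have : t.IsGE R (n + 1) := ⟨hR⟩
  have : t.IsGE L n := isGE₁ hT n inferInstance (t.isGE_of_ge _ _ (n + 1))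
  obtain ⟨Z, ⟨e⟩⟩ := exists_iso_singleFunctor_obj_of_isGE_of_isLE L n
  let Φ := (fp G).ι.mapDerivedCategory
  obtain ⟨g, hg⟩ : ∃ g : _ ⟶ Φ.obj L, f = g ≫ Φ.map a :=
    Triangle.coyoneda_exact₂ _ (Φ.map_distinguished _ hT) f (t.zero (f ≫ Φ.map b) n (n + 1))
  let α := (fp G).ι.mapDerivedCategorySingleFunctor n
  obtain ⟨z, hz⟩ := (singleFunctor G n).map_surjective (g ≫ Φ.map e.hom ≫ α.hom.app Z)
  refine ⟨(singleFunctor (Fp G) n).map (ObjectProperty.homMk z) ≫ e.inv ≫ a, ?_⟩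
  have hα : (singleIsoMapDerivedCategory hP n).hom ≫
      Φ.map ((singleFunctor (Fp G) n).map (ObjectProperty.homMk z)) =
        (singleFunctor G n).map z ≫ α.inv.app Z :=
    (α.inv.naturality (X := ⟨P, hP⟩) (Y := Z) (ObjectProperty.homMk z)).symm
  rw [Functor.map_comp, reassoc_of% hα, hz, hg, Functor.map_comp]
  have h₁ : α.hom.app Z ≫ α.inv.app Z = 𝟙 (Φ.obj ((singleFunctor (Fp G) n).obj Z)) :=
    α.hom_inv_id_app Z
  have h₂ : Φ.map e.hom ≫ Φ.map e.inv = 𝟙 _ := by rw [← Φ.map_comp, e.hom_inv_id, Φ.map_id]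
  simp only [Category.assoc]
  rw [reassoc_of% h₁]
  refine Eq.trans ?_ (congrArg (fun k => g ≫ Φ.map e.hom ≫ k) (Category.id_comp _).symm)
  change _ = g ≫ Φ.map e.hom ≫ Φ.map e.inv ≫ Φ.map a
  rw [reassoc_of% h₂]

lemma exists_triangle_of_lift {P : G} (hP : fp G P) {n : ℤ} {K : DerivedCategory (Fp G)}
    (hK : t.IsGE K n) (hK' : t.bounded K)
    (f : (singleFunctor G n).obj P ⟶ (fp G).ι.mapDerivedCategory.obj K) :
    ∃ (K' : DerivedCategory (Fp G)) (_ : t.bounded K') (_ : t.IsGE K' (n - 1))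
      (g : (fp G).ι.mapDerivedCategory.obj K ⟶ (fp G).ι.mapDerivedCategory.obj K')
      (h : (fp G).ι.mapDerivedCategory.obj K' ⟶ ((singleFunctor G n).obj P)⟦(1 : ℤ)⟧),
      Triangle.mk f g h ∈ distTriang _ := by
  obtain ⟨f', rfl⟩ := exists_lift_of_isGE hP hK f
  obtain ⟨K', g, h, hT⟩ := distinguished_cocone_triangle f'
  refine ⟨K', ?_, ?_, _, _, distTriang_of_isos
    ((fp G).ι.mapDerivedCategory.map_distinguished _ hT) (singleIsoMapDerivedCategory hP n)
    (Iso.refl _)⟩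
  · exact t.bounded.ext_of_isTriangulatedClosed₃ _ hT
      ⟨⟨n, inferInstanceAs (t.IsGE ((singleFunctor (Fp G) n).obj ⟨P, hP⟩) n)⟩,
        ⟨n, inferInstanceAs (t.IsLE ((singleFunctor (Fp G) n).obj ⟨P, hP⟩) n)⟩⟩ hK'
  · exact t.isGE₂ _ (rot_of_distTriang _ hT) (n - 1) (t.isGE_of_ge K (n - 1) n)
      (t.isGE_shift ((singleFunctor (Fp G) n).obj ⟨P, hP⟩) n 1 (n - 1))

lemma fpInfty_mapDerivedCategory {K : DerivedCategory (Fp G)} (hK : t.bounded K) :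
    fpInfty G ((fp G).ι.mapDerivedCategory.obj K) :=
  fun _ _ _ _ _ _ hc =>
    prop_mapDerivedCategory_of_bounded _ (fun n _ hF => shiftClosure_single hc n hF) hK

/-- Each step attaches one stalk. The error `E` is of type `FP_∞` by two-out-of-three, so its top
degree is approximated by some `P`; the cone of the lifted map `P[-n] ⟶ K` is the new `K`, and the
octahedron identifies the new error with the cone of `P[-n] ⟶ E`. -/
lemma fpInfty.exists_triangle {X : DerivedCategory G} (hX : fpInfty G X) {b : ℤ}
    (hXb : t.IsLE X b) (k : ℕ) :
    ∃ (E : DerivedCategory G) (_ : t.IsLE E (b + 1 - k)) (K : DerivedCategory (Fp G))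
      (_ : t.bounded K) (_ : t.IsGE K (b + 1 - k))
      (f : E ⟶ (fp G).ι.mapDerivedCategory.obj K) (g : (fp G).ι.mapDerivedCategory.obj K ⟶ X)
      (h : X ⟶ E⟦(1 : ℤ)⟧), Triangle.mk f g h ∈ distTriang _ := by
  induction k with
  | zero =>
    -- Start from `K = 0`, so that `E` is `X⟦-1⟧`, bounded above by `b + 1`.
    obtain ⟨E, f, h, hT⟩ := distinguished_cocone_triangle₁
      (0 : (fp G).ι.mapDerivedCategory.obj 0 ⟶ X)
    have h₀ : IsZero ((fp G).ι.mapDerivedCategory.obj (0 : DerivedCategory (Fp G))) :=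
      Functor.map_isZero _ (isZero_zero _)
    refine ⟨E, ?_, 0, t.bounded.prop_zero, inferInstance, f, 0, h, hT⟩
    exact t.isLE₂ _ (inv_rot_of_distTriang _ hT) _
      (t.isLE_shift X b (-1) _) (t.isLE_of_isZero h₀ _)
  | succ k hk =>
    obtain ⟨E, hE, K, hK, hK', f, g, h, hT⟩ := hk
    have hE' : fpInfty G E := (fpInfty G).ext_of_isTriangulatedClosed₁ _ hT
      (fpInfty_mapDerivedCategory hK) hX
    obtain ⟨P, hP, Y, hY, p, r, s, hp⟩ := hE'.exists_approximation hE
    obtain ⟨K₁, hK₁, hK₁', g₁, h₁, hT₁⟩ := exists_triangle_of_lift hP hK' hK (p ≫ f)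
    have hk : b + 1 - (k + 1 : ℕ) = b + 1 - k - 1 := by push_cast; ring
    rw [hk]
    exact ⟨Y, hY, K₁, hK₁, hK₁', _, _, _, (someOctahedron rfl hp hT hT₁).mem⟩

lemma fpInfty.exists_iso {X : DerivedCategory G} (hX : fpInfty G X) (hX' : t.bounded X) :
    ∃ (K : DerivedCategory (Fp G)) (_ : t.bounded K),
      Nonempty ((fp G).ι.mapDerivedCategory.obj K ≅ X) := by
  obtain ⟨⟨a, ha⟩, ⟨b, hb⟩⟩ := hX'
  -- This number of steps brings the bound to `n = min a (b + 1)`, at most `a`, so `E` is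
  -- concentrated in degree `n`.
  obtain ⟨E, hE, K, hK, hK', f, g, h, hT⟩ := hX.exists_triangle hb (b + 1 - a).toNat
  generalize hn : b + 1 - ((b + 1 - a).toNat : ℤ) = n at hE hK'
  have : t.IsGE E n := isGE₁ hT n inferInstance (t.isGE_of_ge X _ a)
  have hE' : fpInfty G E := (fpInfty G).ext_of_isTriangulatedClosed₁ _ hT
    (fpInfty_mapDerivedCategory hK) hX
  obtain ⟨A, ⟨e⟩⟩ := exists_iso_singleFunctor_obj_of_isGE_of_isLE E n
  have hA : fp G A := hE'.fp_of_triangle inferInstance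
    (distTriang_of_isos (contractible_distinguished₁ E) (Iso.refl _) e)
  obtain ⟨K₁, hK₁, -, g₁, h₁, hT₁⟩ := exists_triangle_of_lift hA hK' hK (e.inv ≫ f)
  exact ⟨K₁, hK₁, ⟨Triangle.π₃.mapIso (isoTriangleOfIso₁₂ _ _ hT₁ hT e.symm (Iso.refl _)
    (Category.comp_id (e.inv ≫ f)))⟩⟩

lemma boundedFp_of_isFPInfty {X : Bounded G} (hX : IsFPInfty X) : boundedFp.{w₁, w₂} G X := by
  obtain ⟨K, hK, ⟨e⟩⟩ := fpInfty.exists_iso.{w₁, w₂} ((isFPInfty_iff X).1 hX) X.property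
  exact ⟨⟨K, hK⟩, ⟨ObjectProperty.isoMk _ e⟩⟩

end

end

/-! ### Compactness of the objects of `D^b(fp G)` -/

section
open DerivedCategory Pretriangulated Triangulated DerivedCategory.TStructure

section

variable {T : Type u} [Category.{w} T] [Preadditive T] {J : Type v} {Y : J → T} {c : Cofan Y}

open Classical in
/-- The projections from a coproduct. -/
def cofanProj (hc : IsColimit c) (j : J) : c.pt ⟶ Y j :=
  Cofan.IsColimit.desc hc (fun i => if h : i = j then eqToHom (by rw [h]) else 0)

lemma inj_cofanProj_self (hc : IsColimit c) (j : J) : c.inj j ≫ cofanProj hc j = 𝟙 _ := by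
  simp [cofanProj]

lemma inj_cofanProj_of_ne (hc : IsColimit c) {i j : J} (h : i ≠ j) :
    c.inj i ≫ cofanProj hc j = 0 := by
  simp [cofanProj, h]

/-- The idempotent endomorphism of a coproduct which projects to a finite part. -/
def cofanIdem (hc : IsColimit c) (s : Finset J) : c.pt ⟶ c.pt :=
  ∑ j ∈ s, cofanProj hc j ≫ c.inj j

lemma inj_cofanIdem (hc : IsColimit c) {s : Finset J} {j : J} (hj : j ∈ s) :
    c.inj j ≫ cofanIdem hc s = c.inj j := by
  rw [cofanIdem, Preadditive.comp_sum, Finset.sum_eq_single_of_mem j hj]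
  · rw [← Category.assoc, inj_cofanProj_self, Category.id_comp]
  · intro i _ hij
    rw [← Category.assoc, inj_cofanProj_of_ne hc hij.symm, zero_comp]

lemma cofanIdem_comp (hc : IsColimit c) {s t : Finset J} (h : s ⊆ t) :
    cofanIdem hc s ≫ cofanIdem hc t = cofanIdem hc s := by
  rw [cofanIdem, Preadditive.sum_comp]
  refine Finset.sum_congr rfl fun j hj => ?_
  rw [Category.assoc, inj_cofanIdem hc (h hj)]

/-- The projections recover the components of an element of the direct sum, so injectivity is
automatic; only factorization through a finite subsum must be assumed. -/
lemma homDirectSumMap_bijective [DecidableEq J] (hc : IsColimit c) {X : T}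
    (h : ∀ f : X ⟶ c.pt, ∃ s, f ≫ cofanIdem hc s = f) :
    Function.Bijective (homDirectSumMap X c) := by
  have hof (j : J) (g : X ⟶ Y j) :
      homDirectSumMap X c (DirectSum.of (fun j => X ⟶ Y j) j g) = g ≫ c.inj j :=
    DirectSum.toAddMonoid_of _ _ _
  constructor
  · rw [injective_iff_map_eq_zero]
    intro z hz
    have hz' (j : J) : homDirectSumMap X c z ≫ cofanProj hc j = z j := by
      clear hz
      induction z using DirectSum.induction_on with
      | zero => rw [map_zero, zero_comp]; rfl
      | of i g =>
        rw [hof, Category.assoc]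
        obtain rfl | hij := eq_or_ne i j
        · rw [inj_cofanProj_self, Category.comp_id, DirectSum.of_eq_same]
        · rw [inj_cofanProj_of_ne hc hij, comp_zero, DirectSum.of_eq_of_ne _ _ _ hij.symm]
      | add x y hx hy => rw [map_add, Preadditive.add_comp, hx, hy]; rfl
    ext j
    rw [← hz', hz, zero_comp]
    rfl
  · intro f
    obtain ⟨s, hs⟩ := h f
    refine ⟨∑ j ∈ s, DirectSum.of (fun j => X ⟶ Y j) j (f ≫ cofanProj hc j), ?_⟩
    refine Eq.trans ?_ hs
    rw [map_sum, cofanIdem, Preadditive.comp_sum]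
    refine Finset.sum_congr rfl fun j _ => ?_
    rw [hof, Category.assoc]

end

section

variable {G : Type u} [Category.{v} G] [Abelian G]

open ZeroObject in
-- Joint epimorphy of the `ε i` says that their cokernels have colimit zero, so `γ` dies in one of
-- these cokernels.
lemma exists_comp_eq_of_fp {I : Type v} [PartialOrder I] [IsDirectedOrder I] [Nonempty I]
    {H : G} (ε : I → (H ⟶ H)) (hε : ∀ i j, i ≤ j → ε i ≫ ε j = ε i)
    (hH : ∀ ⦃V : G⦄ (g : H ⟶ V), (∀ i, ε i ≫ g = 0) → g = 0) {F : G} (hF : fp G F) (γ : F ⟶ H) :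
    ∃ i, γ ≫ ε i = γ := by
  let π (i : I) : H ⟶ cokernel (ε i) := cokernel.π (ε i)
  have hπ {i j : I} (h : i ≤ j) : ε i ≫ π j = 0 := by
    rw [← hε i j h, Category.assoc, cokernel.condition, comp_zero]
  let M : I ⥤ G :=
    { obj := fun i => cokernel (ε i)
      map := fun {i j} f => cokernel.desc (ε i) (π j) (hπ (leOfHom f)) }
  have hM {i j : I} (f : i ⟶ j) : π i ≫ M.map f = π j := cokernel.π_desc _ _ _
  let c : Cocone M := { pt := 0, ι := 0 }
  have hc : IsColimit c :=
    { desc := fun s => 0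
      fac := fun s i => by
        let g (i : I) : H ⟶ s.pt := π i ≫ s.ι.app i
        have hg {i j : I} (h : i ≤ j) : g i = g j := by
          dsimp only [g]
          rw [← hM (homOfLE h), Category.assoc, s.w]
        have h₀ : g i = 0 := hH _ fun j => by
          obtain ⟨k, hik, hjk⟩ := exists_ge_ge i j
          rw [hg hik, ← hg hjk]
          dsimp only [g]
          rw [← Category.assoc, hπ le_rfl, zero_comp]
        have : Epi (π i) := inferInstanceAs (Epi (cokernel.π (ε i)))
        rw [comp_zero]
        exact ((cancel_epi (π i)).1 (h₀.trans comp_zero.symm)).symm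
      uniq := fun s m _ => (isZero_zero G).eq_of_src _ _ }
  have hF : IsFinitelyPresentable.{v} F := hF
  obtain ⟨i⟩ := ‹Nonempty I›
  obtain ⟨j, u, v, huv⟩ := IsFinitelyPresentable.exists_eq_of_isColimit hc (X := F)
    (γ ≫ π i) (0 : F ⟶ M.obj i) ((isZero_zero G).eq_of_tgt _ _)
  have h₀ : γ ≫ π j = 0 := by
    rwa [Category.assoc, hM, zero_comp] at huv
  refine ⟨j, ?_⟩
  -- As `ε j` is idempotent, `𝟙 H - ε j` factors through its cokernel.
  have h₁ := γ ≫= cokernel.π_desc (ε j) (𝟙 H - ε j)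
    (by rw [Preadditive.comp_sub, hε j j le_rfl, Category.comp_id, sub_self])
  rw [reassoc_of% h₀, zero_comp, Preadditive.comp_sub, Category.comp_id] at h₁
  exact (sub_eq_zero.1 h₁.symm).symm

variable [HasDerivedCategory.{w₁} G]

/-- After embedding `V` in an injective, `g` corresponds to a morphism from the coproduct to a
stalk. That stalk lies in `D^b(G)`, so the universal property can test the morphism on each summand.
-/
lemma eq_zero_of_homologyMap_cofanIdem_comp [EnoughInjectives G] {J : Type v} {Y : J → Bounded G}
    {c : Cofan Y} (hc : IsColimit c) {n : ℤ} {V : G}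
    (g : (homologyFunctor G n).obj c.pt.obj ⟶ V)
    (hg : ∀ s, (homologyFunctor G n).map (cofanIdem hc s).hom ≫ g = 0) : g = 0 := by
  rw [← cancel_mono (Injective.ι V), zero_comp]
  obtain ⟨f, hf⟩ := exists_homologyMap_eq_of_injective (g ≫ Injective.ι V)
  let Z : Bounded G := ⟨(singleFunctor G n).obj (Injective.under V),
    ⟨n, inferInstance⟩, ⟨n, inferInstance⟩⟩
  have h₀ (s : Finset J) : (cofanIdem hc s).hom ≫ f = 0 := by
    apply eq_zero_of_injective
    rw [← cancel_mono (homologySingleIso _ n).hom, Functor.map_comp, Category.assoc, hf,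
      reassoc_of% (hg s), zero_comp, zero_comp]
  have h₁ : (ObjectProperty.homMk f : c.pt ⟶ Z) = 0 := by
    refine Cofan.IsColimit.hom_ext hc _ _ fun j => ?_
    rw [← inj_cofanIdem hc (Finset.mem_singleton_self j), Category.assoc]
    have : cofanIdem hc {j} ≫ (ObjectProperty.homMk f : c.pt ⟶ Z) = 0 :=
      ObjectProperty.hom_ext _ (h₀ {j})
    rw [this, comp_zero, comp_zero]
  have h₂ : f = 0 := congrArg (fun k => k.hom) h₁
  rw [← hf, h₂, Functor.map_zero, zero_comp]

/-- The objects all of whose shifts have the property that every morphism to a given coproduct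
factors through a finite part. -/
def finiteSupport {J : Type v} {Y : J → Bounded G} {c : Cofan Y} (hc : IsColimit c) :
    ObjectProperty (DerivedCategory G) := fun X =>
  ∀ (n : ℤ) (f : X⟦n⟧ ⟶ c.pt.obj), ∃ s, f ≫ (cofanIdem hc s).hom = f

section

variable {J : Type v} {Y : J → Bounded G} {c : Cofan Y} (hc : IsColimit c)

lemma cofanIdem_hom_comp {s t : Finset J} (h : s ⊆ t) :
    (cofanIdem hc s).hom ≫ (cofanIdem hc t).hom = (cofanIdem hc s).hom :=
  congrArg (fun k => k.hom) (cofanIdem_comp hc h)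

open Classical in
-- The defect `f - f ≫ e_s` factors through `C`, hence is fixed by some `e_t`; then `e_{s ∪ t}`
-- fixes `f`.
lemma exists_comp_cofanIdem_of_distTriang {A B C : DerivedCategory G} {a : A ⟶ B} {b : B ⟶ C}
    {d : C ⟶ A⟦(1 : ℤ)⟧} (hT : Triangle.mk a b d ∈ distTriang _) (f : B ⟶ c.pt.obj)
    {s : Finset J} (hs : a ≫ f ≫ (cofanIdem hc s).hom = a ≫ f)
    (hC : ∀ g : C ⟶ c.pt.obj, ∃ t, g ≫ (cofanIdem hc t).hom = g) :
    ∃ t, f ≫ (cofanIdem hc t).hom = f := by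
  obtain ⟨g, hg⟩ : ∃ g, f - f ≫ (cofanIdem hc s).hom = b ≫ g :=
    Triangle.yoneda_exact₂ _ hT _ (by
      change a ≫ _ = 0
      rw [Preadditive.comp_sub, hs, sub_self])
  obtain ⟨t, ht⟩ := hC g
  refine ⟨s ∪ t, ?_⟩
  have ht' : g ≫ (cofanIdem hc (s ∪ t)).hom = g := by
    rw [← ht, Category.assoc, cofanIdem_hom_comp hc Finset.subset_union_right]
  have h := hg =≫ (cofanIdem hc (s ∪ t)).hom
  rw [Category.assoc, ht', ← hg, Preadditive.sub_comp, Category.assoc,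
    cofanIdem_hom_comp hc Finset.subset_union_left] at h
  exact sub_left_injective h

instance : (finiteSupport hc).IsClosedUnderIsomorphisms where
  of_iso e h n f := by
    obtain ⟨s, hs⟩ := h n (e.hom⟦n⟧' ≫ f)
    refine ⟨s, (cancel_epi (e.hom⟦n⟧')).1 ?_⟩
    rw [← Category.assoc, hs]

instance : (finiteSupport hc).IsTriangulated where
  exists_zero := ⟨_, isZero_zero _, fun n f => ⟨∅,
    ((shiftFunctor (DerivedCategory G) n).map_isZero (isZero_zero _)).eq_of_src _ _⟩⟩
  isStableUnderShiftBy a :=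
    { le_shift := fun X hX n f => by
        obtain ⟨s, hs⟩ := hX (a + n) ((shiftFunctorAdd _ a n).hom.app X ≫ f)
        refine ⟨s, (cancel_epi ((shiftFunctorAdd _ a n).hom.app X)).1 ?_⟩
        rw [← Category.assoc, hs] }
  ext₂' T hT h₁ h₃ := ObjectProperty.le_isoClosure _ _ fun n f => by
    obtain ⟨s, hs⟩ := h₁ n (((Triangle.shiftFunctor _ n).obj T).mor₁ ≫ f)
    exact exists_comp_cofanIdem_of_distTriang hc (Triangle.shift_distinguished _ hT n) f
      ((Category.assoc _ _ _).symm.trans hs) (h₃ n)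

variable [IsLocallyCoherent G] [EnoughInjectives G]

/-- Induction on the distance from `n` to the lower bound `a` of the coproduct; below `a` all
morphisms vanish. -/
lemma exists_comp_cofanIdem_single (n : ℤ) {F : G} (hF : fp G F)
    (f : (singleFunctor G n).obj F ⟶ c.pt.obj) : ∃ s, f ≫ (cofanIdem hc s).hom = f := by
  obtain ⟨a, ha⟩ := c.pt.property.1
  obtain ⟨k, hk⟩ : ∃ k : ℕ, n < a + k := ⟨(n + 1 - a).toNat, by lia⟩
  induction k generalizing n F with
  | zero =>
    have hf : f = 0 := t.zero f n a
    exact ⟨∅, by rw [hf, zero_comp]⟩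
  | succ k ih =>
    obtain ⟨s, hs⟩ := exists_comp_eq_of_fp
      (fun s => (homologyFunctor G n).map (cofanIdem hc s).hom)
      (fun s t h => by rw [← Functor.map_comp, cofanIdem_hom_comp hc h])
      (fun V g hg => eq_zero_of_homologyMap_cofanIdem_comp hc g hg) hF
      ((homologySingleIso F n).inv ≫ (homologyFunctor G n).map f)
    rw [Category.assoc, cancel_epi] at hs
    obtain ⟨F', P, hF', hP, i, p, _, d, hT, hp⟩ :=
      exists_fp_effacement hF (f - f ≫ (cofanIdem hc s).hom)
        (by rw [Functor.map_sub, Functor.map_comp, hs, sub_self])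
    let e := ((singleFunctors G).shiftIso 1 (n - 1) n (by ring)).app F'
    -- In the rotated triangle from `P` to `F` to `F'⟦1⟧`, the defect vanishes on `P`, and `F'⟦1⟧`
    -- is a stalk in degree `n - 1`.
    refine exists_comp_cofanIdem_of_distTriang hc (rot_of_distTriang _ hT) f (s := s) ?_ fun g => ?_
    · rw [Preadditive.comp_sub, sub_eq_zero] at hp
      exact hp.symm
    · obtain ⟨t, ht⟩ := ih (n - 1) hF' (e.inv ≫ g) (by lia)
      refine ⟨t, (cancel_epi e.inv).1 ?_⟩
      exact (Category.assoc _ _ _).symm.trans ht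

lemma finiteSupport_single (n : ℤ) {F : G} (hF : fp G F) :
    finiteSupport hc ((singleFunctor G n).obj F) := fun a f => by
  let e := ((singleFunctors G).shiftIso a (n - a) n (by ring)).app F
  obtain ⟨s, hs⟩ := exists_comp_cofanIdem_single hc (n - a) hF (e.inv ≫ f)
  refine ⟨s, (cancel_epi e.inv).1 ?_⟩
  rw [← Category.assoc, hs]

end

lemma boundedFp_le_compactObjects [IsLocallyCoherent G] [EnoughInjectives G]
    [HasDerivedCategory.{w₂} (Fp G)] :
    boundedFp.{w₁, w₂} G ≤ compactObjects.{w₁, v} (Bounded G) := by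
  rintro X ⟨K, ⟨e⟩⟩ J Y c hc
  have hX : finiteSupport hc X.obj := ObjectProperty.prop_of_iso _ (Bounded.ι.mapIso e)
    (prop_mapDerivedCategory_of_bounded _ (fun n F hF => finiteSupport_single hc n hF) K.property)
  classical
  refine homDirectSumMap_bijective hc fun f => ?_
  let e₀ := (shiftFunctorZero (DerivedCategory G) ℤ).app X.obj
  obtain ⟨s, hs⟩ := hX 0 (e₀.hom ≫ f.hom)
  refine ⟨s, ObjectProperty.hom_ext _ ((cancel_epi e₀.hom).1 ?_)⟩
  exact (Category.assoc _ _ _).symm.trans hs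

end

end

end LocallyCoherent

end

theorem mainTheorem3 (G : Type u) [Category.{v} G] [Abelian G] [IsGrothendieckAbelian.{v} G]
    [LocallyCoherent.IsLocallyCoherent G] [HasDerivedCategory.{w₁} G]
    [HasDerivedCategory.{w₂} (LocallyCoherent.Fp G)] :
    (∀ X : DerivedCategory.Bounded G,
      LocallyCoherent.IsFPInfty X ↔ LocallyCoherent.boundedFp.{w₁, w₂} G X) ∧
    LocallyCoherent.boundedFp.{w₁, w₂} G ≤
      LocallyCoherent.compactObjects.{w₁, v} (DerivedCategory.Bounded G) := by
  exact ⟨fun X => ⟨LocallyCoherent.boundedFp_of_isFPInfty.{w₁, w₂},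
    LocallyCoherent.isFPInfty_of_boundedFp.{w₁, w₂}⟩,
    LocallyCoherent.boundedFp_le_compactObjects.{w₁, w₂}⟩
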